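/- \textbf{Theorem.} For an integer $s\ge 0$ let $\Pi_s(\mathbb{S}^2)$ denote the space of restrictions to the unit sphere $\mathbb{S}^2\subset\mathbb{R}^3$ of real polynomials in three variables of degree at most $s$, and let $\Pi_s(\mathbb{S}^2)=\{0\}$ for $s<0$. For a positive integer $s$ and $\alpha\in\{0,1\}$ put $$\Theta_{\alpha,s}=\Big\{\tfrac{(2j+\alpha)\pi}{2s}: j=0,1,\dots,2s-1\Big\},$$ and for a function $T$ on $\mathbb{S}^2$ write $\widetilde T(\theta,\phi)=T(\sin\theta\cos\phi,\sin\theta\sin\phi,\cos\theta)$. Let $n$ be an odd positive integer, let $\sigma\ge 1$, and let $\lambda_1,\dots,\lambda_\sigma$ be positive integers. Define $n_0=n$ and $n_k=n_{k-1}-2\lambda_k$ for $1\le k\le\sigma$. Assume that $n_k\ge 0$ for $1\le k\le\sigma-1$ and that $n_\sigma\ge -1$ (so that $n_{k-1}-\lambda_k+1\ge 1$ for all $1\le k\le\sigma$). Let $\theta_{i,k}\in(0,\pi)$, $1\le i\le 2\lambda_k$, $1\le k\le\sigma$, be pairwise distinct angles such that $$\theta_{2\lambda_k+1-l,\,k}=\pi-\theta_{l,k},\qquad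 1\le l\le\lambda_k,\ 1\le k\le\sigma,$$ and such that for each $k$ the latitudes with indices $1\le i\le\lambda_k$ lie on the same side of the equator, i.e. either $\theta_{i,k}<\pi/2$ for all $1\le i\le\lambda_k$, or $\theta_{i,k}>\pi/2$ for all $1\le i\le\lambda_k$. Suppose that $T_n\in\Pi_n(\mathbb{S}^2)$ satisfies, for every $1\le k\le\sigma$, $$\widetilde T_n(\theta_{i,k},\phi)=0\quad\text{for all }\phi\in\Theta_{0,\,n_{k-1}-\lambda_k+1},\ 1\le i\le\lambda_k,$$ $$\widetilde T_n(\theta_{i,k},\phi)=0\quad\text{for all }\phi\in\Theta_{1,\,n_{k-1}-\lambda_k+1},\ \lambda_k+1\le i\le 2\lambda_k.$$ Then there exists $T^*_{n_\sigma}\in\Pi_{n_\sigma}(\mathbb{S}^2)$ such that $$T_n(x,y,z)=\prod_{k=1}^{\sigma}\prod_{i=1}^{2\lambda_k}(z-\cos\theta_{i,k})\;T^*_{n_\sigma}(x,y,z),\qquad (x,y,z)\in\mathbb{S}^2.$$ In particular, $T_n\equiv 0$ on $\mathbb{S}^2$ if $n_\sigma<0$. -/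

import Mathlib

noncomputable section

/-- The unit sphere of Euclidean three-space. -/
abbrev UnitSphere2 : Type := Metric.sphere (0 : EuclideanSpace ℝ (Fin 3)) 1

/-- Evaluation of a real polynomial in three variables on the unit sphere, as a linear map. -/
def sphereEval : MvPolynomial (Fin 3) ℝ →ₗ[ℝ] (UnitSphere2 → ℝ) :=
  LinearMap.pi fun p => (MvPolynomial.aeval fun i => p.1 i).toLinearMap

/-- The space of spherical polynomials of degree at most `n`: restrictions to the unit sphere of
real polynomials in three variables all of whose monomials have total degree at most `n`.
The degree bound is an integer; for `n < 0` the space is zero. -/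
def sphericalPoly (n : ℤ) : Submodule ℝ (UnitSphere2 → ℝ) :=
  (MvPolynomial.restrictSupport ℝ {d : Fin 3 →₀ ℕ | (d.degree : ℤ) ≤ n}).map sphereEval

theorem mem_sphericalPoly_natCast (n : ℕ) (T : UnitSphere2 → ℝ) :
    T ∈ sphericalPoly n ↔ ∃ P : MvPolynomial (Fin 3) ℝ, P.totalDegree ≤ n ∧
      ∀ p : UnitSphere2, T p = MvPolynomial.eval (fun i => p.1 i) P := by
  have key : ∀ P : MvPolynomial (Fin 3) ℝ,
      P ∈ MvPolynomial.restrictSupport ℝ {d : Fin 3 →₀ ℕ | (d.degree : ℤ) ≤ (n : ℤ)} ↔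
        P.totalDegree ≤ n := by
    intro P
    rw [MvPolynomial.mem_restrictSupport_iff, MvPolynomial.totalDegree_eq, Finset.sup_le_iff]
    simp [Set.subset_def, Finsupp.card_toMultiset, Finsupp.degree_apply, Finsupp.sum]
    norm_cast
  constructor
  · rintro ⟨P, hP, rfl⟩
    exact ⟨P, (key P).1 hP, fun p => by simp [sphereEval, MvPolynomial.aeval_eq_eval]⟩
  · rintro ⟨P, hP, h⟩
    exact ⟨P, (key P).2 hP, funext fun p => by
      simp [sphereEval, MvPolynomial.aeval_eq_eval, h p]⟩

theorem sphericalPoly_of_neg {n : ℤ} (hn : n < 0) : sphericalPoly n = ⊥ := by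
  have h : {d : Fin 3 →₀ ℕ | (d.degree : ℤ) ≤ n} = ∅ := by
    ext d
    simp only [Set.mem_ofPred_eq, Set.mem_empty_iff_false, iff_false]
    omega
  rw [sphericalPoly, h, eq_bot_iff]
  rintro _ ⟨P, hP, rfl⟩
  have hP0 : P = 0 := by
    have := (MvPolynomial.mem_restrictSupport_iff ℝ).1 hP
    simpa using this
  simp [hP0]

/-- The point of the unit sphere with polar angle `θ` and azimuth `φ`. -/
def spherePoint (θ φ : ℝ) : UnitSphere2 :=
  ⟨!₂[Real.sin θ * Real.cos φ, Real.sin θ * Real.sin φ, Real.cos θ], by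
    rw [mem_sphere_zero_iff_norm, EuclideanSpace.norm_eq, Real.sqrt_eq_one, Fin.sum_univ_three]
    simp only [Real.norm_eq_abs, sq_abs]
    simp
    nlinarith [Real.sin_sq_add_cos_sq θ, Real.sin_sq_add_cos_sq φ]⟩

/-- A function on the sphere in spherical coordinates. -/
def inAngles (T : UnitSphere2 → ℝ) (θ φ : ℝ) : ℝ := T (spherePoint θ φ)

/-- The `2s` equidistant angles `(2j + α)π / (2s)`, `j = 0, …, 2s - 1`. -/
def equidistantAngles (α : ℝ) (s : ℤ) : Set ℝ :=
  {φ | ∃ j : ℤ, 0 ≤ j ∧ j ≤ 2 * s - 1 ∧ φ = (2 * j + α) * Real.pi / (2 * s)}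

/-- `n₀ = n` and `n_k = n_{k-1} - 2 λ_k`. -/
def degreeSeq (n : ℤ) (lam : ℕ → ℕ) : ℕ → ℤ
  | 0 => n
  | k + 1 => degreeSeq n lam k - 2 * lam (k + 1)

end

/-! Write w = x + iy. On the sphere, T is a sum of P_j(z) Re w^j + Q_j(z) Im w^j with deg P_j, deg
Q_j < M - j, where M is the degree bound plus one. Put s = n_{k-1} - λ_k + 1 and λ = λ_k, so that M
= s + λ. Vanishing at the 2s equidistant angles of one latitude couples the coefficient of index j
only with that of index 2s - j, with a sign ε = 1 for `Θ_0` and ε = -1 for `Θ_1`. If j ≤ s - λ, the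
partner is zero for degree reasons, so the coefficient itself vanishes on all 2λ latitudes.

If s - λ < j ≤ s, put N = s - j, u = P_j and v = ±P_{2s-j}. Then u + (1 - X²)^N v vanishes at the λ
nodes x_i = cos θ_i, and u - (1 - X²)^N v vanishes at the mirrored nodes -x_i. With R = ∏ (X - x_i)
these polynomials are R·S and R(-X)·V with deg S, deg V < N, so (1 - X²)^N divides R·S - R(-X)·V.
Since all x_i lie on one side of 0, R(-X)/R is up to sign a Blaschke product of a half-plane, and a
Schur algorithm lowering N by one at a time gives S = V = 0 (`HasRightRoots.eq_zero_of_dvd`). Hence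
u = v = 0.

Thus every coefficient that matters is divisible by ∏ (X - cos θ_i) over the 2λ latitudes, and
dividing lowers the degree bound by 2λ (`HasAzimuthalExpansion.exists_factor`). As all latitudes are
distinct, the quotient inherits the remaining zeros, and induction on k finishes. -/

/-! ### Right half-plane roots and the Schur algorithm -/

open Polynomial in
/-- All complex roots of the real polynomial `P` lie in the open right half-plane. -/
def HasRightRoots (P : Polynomial ℝ) : Prop :=
  ∀ z : ℂ, aeval z P = 0 → 0 < z.re

theorem HasRightRoots.ne_zero {P : Polynomial ℝ} (hP : HasRightRoots P) : P ≠ 0 := by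
  rintro rfl
  simpa using hP 0 (by simp)

/-- The point -conj z is the reflection of z in the imaginary axis, hence strictly closer than z to
every point of the right half-plane. -/
theorem prod_norm_reflection_lt {z : ℂ} (hz : z.re < 0) (s : Multiset ℂ)
    (hs : ∀ a ∈ s, 0 < a.re) (h0 : s ≠ 0) :
    (s.map fun a => ‖-(starRingEnd ℂ) z - a‖).prod < (s.map fun a => ‖z - a‖).prod := by
  have one : ∀ a : ℂ, 0 < a.re → ‖-(starRingEnd ℂ) z - a‖ < ‖z - a‖ := by
    intro a ha
    rw [← sq_lt_sq₀ (norm_nonneg _) (norm_nonneg _), ← Complex.normSq_eq_norm_sq,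
      ← Complex.normSq_eq_norm_sq, Complex.normSq_apply, Complex.normSq_apply]
    simp
    nlinarith
  induction s using Multiset.induction with
  | empty => exact absurd rfl h0
  | cons a s ih =>
    have ha := one a (hs a (Multiset.mem_cons_self a s))
    rw [Multiset.map_cons, Multiset.map_cons, Multiset.prod_cons, Multiset.prod_cons]
    by_cases h : s = 0
    · simpa [h] using ha
    · refine mul_lt_mul'' ha (ih (fun b hb => hs b (Multiset.mem_cons_of_mem hb)) h)
        (norm_nonneg _) (Multiset.prod_nonneg ?_)
      intro x hx
      obtain ⟨b, -, rfl⟩ := Multiset.mem_map.1 hx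
      exact norm_nonneg _

theorem norm_aeval_conj (P : Polynomial ℝ) (z : ℂ) :
    ‖Polynomial.aeval ((starRingEnd ℂ) z) P‖ = ‖Polynomial.aeval z P‖ := by
  rw [Polynomial.aeval_conj, RCLike.norm_conj]

theorem norm_aeval_eq_prod_roots (P : Polynomial ℝ) (z : ℂ) :
    ‖Polynomial.aeval z P‖ = ‖P.leadingCoeff‖ *
      ((P.map (algebraMap ℝ ℂ)).roots.map fun a => ‖z - a‖).prod := by
  have h := (IsAlgClosed.splits (P.map (algebraMap ℝ ℂ))).eq_prod_roots
  rw [← Polynomial.eval_map_algebraMap]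
  conv_lhs => rw [h]
  rw [Polynomial.eval_mul, Polynomial.eval_C, norm_mul, Polynomial.eval_multiset_prod,
    Multiset.map_map]
  have hn : ∀ t : Multiset ℂ, ‖t.prod‖ = (t.map norm).prod := fun t =>
    map_multiset_prod (normHom : ℂ →*₀ ℝ) t
  rw [hn, Multiset.map_map]
  simp [Function.comp_def]

/-- Real coefficients allow -z to be replaced by -conj z without changing the modulus; the
comparison is then made root by root. -/
theorem HasRightRoots.norm_aeval_neg_lt {P : Polynomial ℝ} (hP : HasRightRoots P)
    (hd : 0 < P.natDegree) {z : ℂ} (hz : z.re < 0) :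
    ‖Polynomial.aeval (-z) P‖ < ‖Polynomial.aeval z P‖ := by
  rw [← norm_aeval_conj P (-z), map_neg, norm_aeval_eq_prod_roots, norm_aeval_eq_prod_roots]
  refine mul_lt_mul_of_pos_left (prod_norm_reflection_lt hz _ ?_ ?_) ?_
  · intro a ha
    refine hP a ?_
    rw [← Polynomial.eval_map_algebraMap]
    exact (Polynomial.mem_roots'.1 ha).2
  · intro h
    have := (IsAlgClosed.splits (P.map (algebraMap ℝ ℂ))).natDegree_eq_card_roots
    rw [h, Polynomial.natDegree_map] at this
    simp at this
    omega
  · simpa using hP.ne_zero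

theorem aeval_ofReal_norm (P : Polynomial ℝ) (x : ℝ) :
    ‖Polynomial.aeval (x : ℂ) P‖ = |P.eval x| := by
  have : Polynomial.aeval (x : ℂ) P = ((P.eval x : ℝ) : ℂ) := by
    simpa using Polynomial.aeval_algebraMap_apply ℂ x P
  rw [this, Complex.norm_real, Real.norm_eq_abs]

theorem coeff_comp_neg_X (P : Polynomial ℝ) (k : ℕ) :
    (P.comp (-Polynomial.X)).coeff k = P.coeff k * (-1) ^ k := by
  rw [← Polynomial.comp_C_mul_X_coeff]
  simp

theorem natDegree_lt_of_mem_degreeLT {K : Type*} [Semiring K] {P : Polynomial K} {d : ℕ}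
    (hd : 0 < d) (hP : P ∈ Polynomial.degreeLT K d) : P.natDegree < d := by
  by_cases h : P = 0
  · simpa [h] using hd
  · exact (Polynomial.natDegree_lt_iff_degree_lt h).2 (Polynomial.mem_degreeLT.1 hP)

/-- One step of the Schur algorithm: γ is chosen so that P - γ P(-X) vanishes at 1. A zero z of this
difference satisfies |P(z)| = |γ| |P(-z)| with |γ| < 1. This is impossible for Re z < 0, where
|P(-z)| < |P(z)|, and for Re z = 0, where the two moduli are equal and nonzero. -/
theorem HasRightRoots.exists_schur_step {P : Polynomial ℝ} (hP : HasRightRoots P)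
    (hd : 0 < P.natDegree) : ∃ (γ : ℝ) (Q : Polynomial ℝ), γ ^ 2 < 1 ∧
      P.eval 1 = γ * P.eval (-1) ∧ P.eval (-1) ≠ 0 ∧
      P - Polynomial.C γ * P.comp (-Polynomial.X) = (1 - Polynomial.X) * Q ∧
      HasRightRoots Q ∧ P.natDegree ≤ Q.natDegree + 1 := by
  have hlt : |P.eval 1| < |P.eval (-1)| := by
    have := hP.norm_aeval_neg_lt hd (z := ((-1 : ℝ) : ℂ)) (by simp)
    rw [aeval_ofReal_norm] at this
    have h1 : -((-1 : ℝ) : ℂ) = ((1 : ℝ) : ℂ) := by simp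
    rwa [h1, aeval_ofReal_norm] at this
  have hne : P.eval (-1) ≠ 0 := abs_pos.1 ((abs_nonneg _).trans_lt hlt)
  set γ := P.eval 1 / P.eval (-1) with hγ
  have hγ1 : |γ| < 1 := by
    rw [hγ, abs_div, div_lt_one (abs_pos.2 hne)]
    exact hlt
  have hγ2 : γ ^ 2 < 1 := (sq_lt_one_iff_abs_lt_one γ).2 hγ1
  have hγe : P.eval 1 = γ * P.eval (-1) := by rw [hγ, div_mul_cancel₀ _ hne]
  have hroot : (P - Polynomial.C γ * P.comp (-Polynomial.X)).IsRoot 1 := by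
    simp [hγe]
  obtain ⟨Q', hQ'⟩ := Polynomial.dvd_iff_isRoot.2 hroot
  have hQ : P - Polynomial.C γ * P.comp (-Polynomial.X) = (1 - Polynomial.X) * (-Q') := by
    rw [hQ', Polynomial.C_1]; ring
  refine ⟨γ, -Q', hγ2, hγe, hne, hQ, ?_, ?_⟩
  · intro z hz
    have h0 : Polynomial.aeval z P = γ * Polynomial.aeval (-z) P := by
      have := congrArg (Polynomial.aeval z) hQ
      rw [map_mul, hz, mul_zero, map_sub, map_mul, Polynomial.aeval_C, Polynomial.aeval_comp,
        sub_eq_zero] at this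
      simpa using this
    have hn : ‖Polynomial.aeval z P‖ = |γ| * ‖Polynomial.aeval (-z) P‖ := by
      rw [h0, norm_mul, Complex.norm_real, Real.norm_eq_abs]
    by_contra hre
    rcases lt_or_eq_of_le (not_lt.1 hre) with h | h
    · have := hP.norm_aeval_neg_lt hd h
      nlinarith [norm_nonneg (Polynomial.aeval (-z) P)]
    · have hz' : -z = (starRingEnd ℂ) z := by
        apply Complex.ext <;> simp [h]
      rw [hz', norm_aeval_conj] at hn
      have hpos : 0 < ‖Polynomial.aeval z P‖ := by
        rw [norm_pos_iff]
        intro h'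
        exact hre (hP z h')
      nlinarith
  -- The top coefficient is multiplied by 1 - γ(-1)^deg P, nonzero as |γ| < 1, so only the division
  -- by 1 - X can lower the degree.
  · have hc : (P - Polynomial.C γ * P.comp (-Polynomial.X)).coeff P.natDegree ≠ 0 := by
      rw [Polynomial.coeff_sub, Polynomial.coeff_C_mul, coeff_comp_neg_X]
      have hl : P.coeff P.natDegree ≠ 0 := by simpa using hP.ne_zero
      intro h
      have h2 : P.coeff P.natDegree * (1 - γ * (-1) ^ P.natDegree) = 0 := by
        rw [← h]; ring
      rcases mul_eq_zero.1 h2 with h3 | h3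
      · exact hl h3
      · have h5 : |γ * (-1) ^ P.natDegree| = 1 := by
          rw [← sub_eq_zero.1 h3, abs_one]
        rw [abs_mul, abs_pow, abs_neg, abs_one, one_pow, mul_one] at h5
        exact hγ1.ne h5
    refine (Polynomial.le_natDegree_of_ne_zero hc).trans ?_
    rw [hQ]
    refine Polynomial.natDegree_mul_le.trans ?_
    have : (1 - Polynomial.X : Polynomial ℝ).natDegree ≤ 1 := by
      rw [← Polynomial.C_1]; compute_degree
    omega

theorem degree_lt_of_linear_mul {R L : Polynomial ℝ} {N : ℕ} (hL : L.degree = 1)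
    (h : (L * R).degree < ((N + 1 : ℕ) : WithBot ℕ)) : R.degree < (N : WithBot ℕ) := by
  by_cases hR : R = 0
  · simp only [hR, Polynomial.degree_zero]; exact WithBot.bot_lt_coe N
  · rw [Polynomial.degree_mul, hL, Polynomial.degree_eq_natDegree hR] at h
    rw [Polynomial.degree_eq_natDegree hR]
    have h' : 1 + R.natDegree < N + 1 := by exact_mod_cast h
    have : R.natDegree < N := by omega
    exact_mod_cast this

/-- Uniqueness in the Nevanlinna–Pick problem with an `N`-fold node at `1`, in
polynomial form: a polynomial with at least `N` roots, all in the right half-plane, admits no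
nontrivial interpolation relation of order `N` with factors of degree less than `N`. -/
theorem HasRightRoots.eq_zero_of_dvd (N : ℕ) : ∀ {P S V : Polynomial ℝ}, HasRightRoots P →
    N ≤ P.natDegree → S.degree < (N : WithBot ℕ) → V.degree < (N : WithBot ℕ) →
    (1 - Polynomial.X ^ 2) ^ N ∣ P * S - P.comp (-Polynomial.X) * V → S = 0 ∧ V = 0 := by
  induction N with
  | zero =>
    intro P S V _ _ hS hV _
    simpa [Polynomial.degree_lt_iff_coeff_zero, Polynomial.ext_iff] using And.intro hS hV
  | succ N ih =>
    intro P S V hP hN hS hV hdvd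
    obtain ⟨γ, Q, hγ, hγe, hne, hQ, hQr, hQd⟩ := hP.exists_schur_step (by omega)
    obtain ⟨W, hW⟩ := hdvd
    have hQ' : P.comp (-Polynomial.X) - Polynomial.C γ * P =
        (1 + Polynomial.X) * Q.comp (-Polynomial.X) := by
      have := congrArg (fun R => R.comp (-Polynomial.X)) hQ
      simpa [Polynomial.comp_assoc] using this
    -- Evaluating the divisibility relation at 1 and at -1 makes V - γS and S - γV divisible by X -
    -- 1 and X + 1 respectively.
    have e1 : V.eval 1 = γ * S.eval 1 := by
      have := congrArg (Polynomial.eval 1) hW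
      simp only [Polynomial.eval_sub, Polynomial.eval_mul, Polynomial.eval_comp, hγe,
        Polynomial.eval_neg, Polynomial.eval_X, Polynomial.eval_pow, Polynomial.eval_one] at this
      apply mul_left_cancel₀ hne
      simp at this
      linarith
    have e2 : S.eval (-1) = γ * V.eval (-1) := by
      have := congrArg (Polynomial.eval (-1)) hW
      simp only [Polynomial.eval_sub, Polynomial.eval_mul, Polynomial.eval_comp, neg_neg, hγe,
        Polynomial.eval_neg, Polynomial.eval_X, Polynomial.eval_pow, Polynomial.eval_one] at this
      apply mul_left_cancel₀ hne
      simp at this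
      linarith
    obtain ⟨S1, hS1⟩ : (Polynomial.X - Polynomial.C (-1 : ℝ)) ∣ S - Polynomial.C γ * V :=
      Polynomial.dvd_iff_isRoot.2 (by simp [e2])
    obtain ⟨V1', hV1'⟩ : (Polynomial.X - Polynomial.C (1 : ℝ)) ∣ V - Polynomial.C γ * S :=
      Polynomial.dvd_iff_isRoot.2 (by simp [e1])
    have hsub : ∀ A B : Polynomial ℝ, A.degree < ((N + 1 : ℕ) : WithBot ℕ) →
        B.degree < ((N + 1 : ℕ) : WithBot ℕ) →
        (A - Polynomial.C γ * B).degree < ((N + 1 : ℕ) : WithBot ℕ) := by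
      intro A B hA hB
      rw [← Polynomial.mem_degreeLT] at hA hB ⊢
      rw [← Polynomial.smul_eq_C_mul]
      exact Submodule.sub_mem _ hA (Submodule.smul_mem _ _ hB)
    have dS1 : S1.degree < (N : WithBot ℕ) :=
      degree_lt_of_linear_mul (Polynomial.degree_X_sub_C _) (hS1 ▸ hsub S V hS hV)
    have dV1 : V1'.degree < (N : WithBot ℕ) :=
      degree_lt_of_linear_mul (Polynomial.degree_X_sub_C _) (hV1' ▸ hsub V S hV hS)
    have hX : (1 - Polynomial.X ^ 2 : Polynomial ℝ) ≠ 0 := by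
      intro h
      simpa using congrArg (Polynomial.eval 0) h
    rw [map_neg, Polynomial.C_1] at hS1
    rw [Polynomial.C_1] at hV1'
    -- With P' = P(-X), the identity (P - γP')(S - γV) - (P' - γP)(V - γS) = (1 - γ²)(PS - P'V)
    -- shows that the transformed data satisfy the same relation, with one factor 1 - X² cancelled.
    have key : Q * S1 - Q.comp (-Polynomial.X) * (-V1') =
        (1 - Polynomial.X ^ 2) ^ N * (Polynomial.C (1 - γ ^ 2) * W) := by
      apply mul_left_cancel₀ hX
      rw [map_sub, map_pow, Polynomial.C_1]
      linear_combination (-(S - Polynomial.C γ * V)) * hQ +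
        (-(1 - Polynomial.X) * Q) * hS1 +
        (V - Polynomial.C γ * S) * hQ' + ((1 + Polynomial.X) * Q.comp (-Polynomial.X)) * hV1' +
        (1 - Polynomial.C γ ^ 2) * hW
    obtain ⟨z1, z2⟩ := ih hQr (by omega) dS1 (by rwa [Polynomial.degree_neg]) ⟨_, key⟩
    rw [neg_eq_zero] at z2
    rw [z1, mul_zero, sub_eq_zero] at hS1
    rw [z2, mul_zero, sub_eq_zero] at hV1'
    have hS0 : Polynomial.C (1 - γ ^ 2) * S = 0 := by
      rw [map_sub, map_pow, Polynomial.C_1]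
      linear_combination hS1 + Polynomial.C γ * hV1'
    have hγ0 : Polynomial.C (1 - γ ^ 2) ≠ 0 := by
      rw [Polynomial.C_ne_zero]; linarith
    have : S = 0 := (mul_eq_zero.1 hS0).resolve_left hγ0
    exact ⟨this, by rw [hV1', this, mul_zero]⟩

/-! ### Polynomials with prescribed mirror-symmetric zeros -/

theorem hasRightRoots_prod {ι : Type*} (I : Finset ι) (x : ι → ℝ) (hx : ∀ i ∈ I, 0 < x i) :
    HasRightRoots (∏ i ∈ I, (Polynomial.X - Polynomial.C (x i))) := by
  intro z hz
  rw [map_prod, Finset.prod_eq_zero_iff] at hz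
  obtain ⟨i, hi, h⟩ := hz
  have : z = (x i : ℂ) := by simpa [sub_eq_zero] using h
  rw [this]
  simpa using hx i hi

theorem prod_X_sub_C_dvd {ι : Type*} {I : Finset ι} {x : ι → ℝ} (hinj : Set.InjOn x I)
    {f : Polynomial ℝ} (hf : ∀ i ∈ I, f.eval (x i) = 0) :
    (∏ i ∈ I, (Polynomial.X - Polynomial.C (x i))) ∣ f := by
  refine Finset.prod_dvd_of_coprime ?_ fun i hi => Polynomial.dvd_iff_isRoot.2 (hf i hi)
  intro i hi j hj hij
  exact Polynomial.isCoprime_X_sub_C_of_isUnit_sub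
    (sub_ne_zero.2 fun h => hij (hinj hi hj h)).isUnit

theorem exists_prod_X_sub_C_mul {ι : Type*} {I : Finset ι} {x : ι → ℝ} (hinj : Set.InjOn x I)
    {f : Polynomial ℝ} (hf : ∀ i ∈ I, f.eval (x i) = 0) {d : ℕ}
    (hd : f ∈ Polynomial.degreeLT ℝ d) :
    ∃ g ∈ Polynomial.degreeLT ℝ (d - I.card),
      f = (∏ i ∈ I, (Polynomial.X - Polynomial.C (x i))) * g := by
  obtain ⟨g, hg⟩ := prod_X_sub_C_dvd hinj hf
  refine ⟨g, ?_, hg⟩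
  by_cases h0 : g = 0
  · rw [h0]; exact Submodule.zero_mem _
  rw [Polynomial.mem_degreeLT] at hd ⊢
  have hm : (∏ i ∈ I, (Polynomial.X - Polynomial.C (x i))).Monic :=
    Polynomial.monic_prod_of_monic _ _ fun i _ => Polynomial.monic_X_sub_C _
  have hn : (∏ i ∈ I, (Polynomial.X - Polynomial.C (x i))).natDegree = I.card := by
    rw [Polynomial.natDegree_prod_of_monic _ _ fun i _ => Polynomial.monic_X_sub_C _]
    simp
  rw [hg, Polynomial.degree_mul, Polynomial.degree_eq_natDegree hm.ne_zero, hn,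
    Polynomial.degree_eq_natDegree h0] at hd
  rw [Polynomial.degree_eq_natDegree h0]
  have hd' : I.card + g.natDegree < d := by exact_mod_cast hd
  have : g.natDegree < d - I.card := by omega
  exact_mod_cast this

/-- Factoring the nodes out of u + wv and of (u - wv)(-X), where w = (1 - X²)^N, leaves cofactors of
degree less than N. The difference of the two factorizations is 2wv, so Nevanlinna–Pick uniqueness
kills both cofactors. -/
theorem eq_zero_of_mirror_zeros_of_pos {ι : Type*} {I : Finset ι} {x : ι → ℝ}
    (hinj : Set.InjOn x I) (hpos : ∀ i ∈ I, 0 < x i) {N : ℕ} (hN : N < I.card)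
    {u v : Polynomial ℝ} (hu : u ∈ Polynomial.degreeLT ℝ (I.card + N))
    (hv : v ∈ Polynomial.degreeLT ℝ (I.card - N))
    (h₁ : ∀ i ∈ I, u.eval (x i) + (1 - x i ^ 2) ^ N * v.eval (x i) = 0)
    (h₂ : ∀ i ∈ I, u.eval (-x i) - (1 - x i ^ 2) ^ N * v.eval (-x i) = 0) :
    u = 0 ∧ v = 0 := by
  set w : Polynomial ℝ := (1 - Polynomial.X ^ 2) ^ N with hw
  have hcomp : ∀ {f : Polynomial ℝ} {d : ℕ}, f ∈ Polynomial.degreeLT ℝ d →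
      f.comp (-Polynomial.X) ∈ Polynomial.degreeLT ℝ d := by
    intro f d hf
    rw [Polynomial.mem_degreeLT, Polynomial.degree_lt_iff_coeff_zero] at hf ⊢
    intro k hk
    rw [coeff_comp_neg_X, hf k hk, zero_mul]
  -- The degree of wv is at most 2N + (card - N - 1), which is less than card + N.
  have hwv : w * v ∈ Polynomial.degreeLT ℝ (I.card + N) := by
    by_cases h0 : v = 0
    · rw [h0, mul_zero]; exact Submodule.zero_mem _
    rw [Polynomial.mem_degreeLT] at hv ⊢
    rw [Polynomial.degree_eq_natDegree h0] at hv
    have hv' : v.natDegree < I.card - N := by exact_mod_cast hv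
    have hwd : w.natDegree ≤ N * 2 := by
      refine Polynomial.natDegree_pow_le.trans (Nat.mul_le_mul_left _ ?_)
      rw [← Polynomial.C_1]; compute_degree
    refine lt_of_le_of_lt (Polynomial.degree_le_natDegree) ?_
    have : (w * v).natDegree < I.card + N := by
      have := Polynomial.natDegree_mul_le (p := w) (q := v)
      omega
    exact_mod_cast this
  have hwc : w.comp (-Polynomial.X) = w := by simp [hw]
  obtain ⟨S, hS, hpS⟩ := exists_prod_X_sub_C_mul hinj (f := u + w * v)
    (fun i hi => by simpa [hw] using h₁ i hi) (Submodule.add_mem _ hu hwv)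
  obtain ⟨V, hV, hpV⟩ := exists_prod_X_sub_C_mul hinj (f := (u - w * v).comp (-Polynomial.X))
    (fun i hi => by simpa [hw] using h₂ i hi) (hcomp (Submodule.sub_mem _ hu hwv))
  set R := ∏ i ∈ I, (Polynomial.X - Polynomial.C (x i)) with hR
  have hRd : R.natDegree = I.card := by
    rw [hR, Polynomial.natDegree_prod_of_monic _ _ fun i _ => Polynomial.monic_X_sub_C _]
    simp
  have hVc : u - w * v = R.comp (-Polynomial.X) * V.comp (-Polynomial.X) := by
    have := congrArg (fun f => Polynomial.comp f (-Polynomial.X)) hpV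
    simpa [Polynomial.comp_assoc] using this
  rw [Nat.add_sub_cancel_left] at hS hV
  obtain ⟨hS0, hV0⟩ := (hasRightRoots_prod I x hpos).eq_zero_of_dvd N (S := S)
    (V := V.comp (-Polynomial.X)) (by rw [← hR, hRd]; exact hN.le) (Polynomial.mem_degreeLT.1 hS)
    (Polynomial.mem_degreeLT.1 (hcomp hV)) ⟨2 * v, by rw [← hR, ← hpS, ← hVc]; ring⟩
  rw [hS0, mul_zero] at hpS
  rw [hV0, mul_zero] at hVc
  have hu0 : u = 0 := by
    have : (2 : Polynomial ℝ) * u = 0 := by linear_combination hpS + hVc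
    exact (mul_eq_zero.1 this).resolve_left two_ne_zero
  refine ⟨hu0, ?_⟩
  rw [hu0, zero_add] at hpS
  refine (mul_eq_zero.1 hpS).resolve_left (pow_ne_zero _ fun h => ?_)
  simpa using congrArg (Polynomial.eval 0) h

/-- Over mirror-symmetric nodes, `u ± (1 - X²) ^ N v` cannot vanish with opposite signs on the two
sides unless `u` and `v` vanish. -/
theorem eq_zero_of_mirror_zeros {ι : Type*} {I : Finset ι} {x : ι → ℝ}
    (hinj : Set.InjOn x I) (hside : (∀ i ∈ I, 0 < x i) ∨ (∀ i ∈ I, x i < 0)) {N : ℕ}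
    (hN : N < I.card)
    {u v : Polynomial ℝ} (hu : u ∈ Polynomial.degreeLT ℝ (I.card + N))
    (hv : v ∈ Polynomial.degreeLT ℝ (I.card - N))
    (h₁ : ∀ i ∈ I, u.eval (x i) + (1 - x i ^ 2) ^ N * v.eval (x i) = 0)
    (h₂ : ∀ i ∈ I, u.eval (-x i) - (1 - x i ^ 2) ^ N * v.eval (-x i) = 0) :
    u = 0 ∧ v = 0 := by
  rcases hside with h | h
  · exact eq_zero_of_mirror_zeros_of_pos hinj h hN hu hv h₁ h₂
  -- Negating both the nodes and v interchanges the two families of equations.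
  · have := eq_zero_of_mirror_zeros_of_pos (x := fun i => -x i) (v := -v)
      (fun i hi j hj hij => hinj hi hj (neg_injective hij)) (fun i hi => neg_pos.2 (h i hi)) hN hu
      (Submodule.neg_mem _ hv) (fun i hi => by simpa [sub_eq_add_neg] using h₂ i hi)
      (fun i hi => by simpa using h₁ i hi)
    simpa using this

/-! ### Expansion of spherical polynomials in the azimuth -/

/-- The complex coordinate `x + i y` on the sphere. -/
def sphereW (p : UnitSphere2) : ℂ := ⟨p.1 0, p.1 1⟩

theorem normSq_sphereW (p : UnitSphere2) :
    p.1 0 * p.1 0 + p.1 1 * p.1 1 = 1 - p.1 2 * p.1 2 := by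
  have h := p.2
  rw [mem_sphere_zero_iff_norm, EuclideanSpace.norm_eq, Real.sqrt_eq_one,
    Fin.sum_univ_three] at h
  simp only [Real.norm_eq_abs, sq_abs] at h
  linarith

/-- The functions `z ^ a * Re (x + i y) ^ j` and `z ^ a * Im (x + i y) ^ j` with `a + j < M`. -/
def azimuthalGenerators (M : ℕ) : Set (UnitSphere2 → ℝ) :=
  {f | ∃ a j : ℕ, a + j < M ∧ ((f = fun p => p.1 2 ^ a * (sphereW p ^ j).re) ∨
    (f = fun p => p.1 2 ^ a * (sphereW p ^ j).im))}

theorem re_mem {M a j : ℕ} (h : a + j < M) :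
    (fun p : UnitSphere2 => p.1 2 ^ a * (sphereW p ^ j).re) ∈
      Submodule.span ℝ (azimuthalGenerators M) :=
  Submodule.subset_span ⟨a, j, h, Or.inl rfl⟩

theorem im_mem {M a j : ℕ} (h : a + j < M) :
    (fun p : UnitSphere2 => p.1 2 ^ a * (sphereW p ^ j).im) ∈
      Submodule.span ℝ (azimuthalGenerators M) :=
  Submodule.subset_span ⟨a, j, h, Or.inr rfl⟩

theorem mul_mem_span_of_generators {M : ℕ} {g : UnitSphere2 → ℝ}
    (hre : ∀ a j, a + j < M → (g * fun p : UnitSphere2 => p.1 2 ^ a * (sphereW p ^ j).re) ∈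
      Submodule.span ℝ (azimuthalGenerators (M + 1)))
    (him : ∀ a j, a + j < M → (g * fun p : UnitSphere2 => p.1 2 ^ a * (sphereW p ^ j).im) ∈
      Submodule.span ℝ (azimuthalGenerators (M + 1)))
    {f : UnitSphere2 → ℝ} (hf : f ∈ Submodule.span ℝ (azimuthalGenerators M)) :
    g * f ∈ Submodule.span ℝ (azimuthalGenerators (M + 1)) := by
  have := (Submodule.map_span_le (LinearMap.mulLeft ℝ g) (azimuthalGenerators M)
    (Submodule.span ℝ (azimuthalGenerators (M + 1)))).2 ?_
  · exact this ⟨f, hf, rfl⟩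
  · rintro _ ⟨a, j, h, rfl | rfl⟩
    · exact hre a j h
    · exact him a j h

/-- From 2x = w + conj w and w · conj w = 1 - z² follows x w^(j+1) = (w^(j+2) + (1 - z²) w^j)/2,
which raises the degree by one only. -/
theorem coord_zero_mul_mem {M : ℕ} {f : UnitSphere2 → ℝ}
    (hf : f ∈ Submodule.span ℝ (azimuthalGenerators M)) :
    (fun p : UnitSphere2 => p.1 0) * f ∈ Submodule.span ℝ (azimuthalGenerators (M + 1)) := by
  refine mul_mem_span_of_generators (fun a j h => ?_) (fun a j h => ?_) hf
  · rcases j with _ | j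
    · convert re_mem (a := a) (j := 1) (M := M + 1) (by omega) using 1
      ext p; simp [sphereW, mul_comm]
    · convert Submodule.add_mem _ (Submodule.smul_mem _ (1 / 2 : ℝ)
        (re_mem (a := a) (j := j + 2) (M := M + 1) (by omega)))
        (Submodule.smul_mem _ (1 / 2 : ℝ) (Submodule.sub_mem _
          (re_mem (a := a) (j := j) (M := M + 1) (by omega))
          (re_mem (a := a + 2) (j := j) (M := M + 1) (by omega)))) using 1
      ext p
      have := normSq_sphereW p
      simp only [Pi.mul_apply, Pi.add_apply, Pi.smul_apply, Pi.sub_apply, smul_eq_mul, pow_succ,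
        Complex.mul_re, Complex.mul_im]
      simp only [sphereW]
      linear_combination (1 / 2 * p.1 2 ^ a * ((⟨p.1 0, p.1 1⟩ : ℂ) ^ j).re) * this
  · rcases j with _ | j
    · convert Submodule.zero_mem _ using 1
      ext p; simp
    · convert Submodule.add_mem _ (Submodule.smul_mem _ (1 / 2 : ℝ)
        (im_mem (a := a) (j := j + 2) (M := M + 1) (by omega)))
        (Submodule.smul_mem _ (1 / 2 : ℝ) (Submodule.sub_mem _
          (im_mem (a := a) (j := j) (M := M + 1) (by omega))
          (im_mem (a := a + 2) (j := j) (M := M + 1) (by omega)))) using 1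
      ext p
      have := normSq_sphereW p
      simp only [Pi.mul_apply, Pi.add_apply, Pi.smul_apply, Pi.sub_apply, smul_eq_mul, pow_succ,
        Complex.mul_re, Complex.mul_im]
      simp only [sphereW]
      linear_combination (1 / 2 * p.1 2 ^ a * ((⟨p.1 0, p.1 1⟩ : ℂ) ^ j).im) * this

/-- The same argument with 2iy = w - conj w; multiplication by y exchanges real and imaginary parts.
-/
theorem coord_one_mul_mem {M : ℕ} {f : UnitSphere2 → ℝ}
    (hf : f ∈ Submodule.span ℝ (azimuthalGenerators M)) :
    (fun p : UnitSphere2 => p.1 1) * f ∈ Submodule.span ℝ (azimuthalGenerators (M + 1)) := by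
  refine mul_mem_span_of_generators (fun a j h => ?_) (fun a j h => ?_) hf
  · rcases j with _ | j
    · convert im_mem (a := a) (j := 1) (M := M + 1) (by omega) using 1
      ext p; simp [sphereW, mul_comm]
    · convert Submodule.sub_mem _ (Submodule.smul_mem _ (1 / 2 : ℝ)
        (im_mem (a := a) (j := j + 2) (M := M + 1) (by omega)))
        (Submodule.smul_mem _ (1 / 2 : ℝ) (Submodule.sub_mem _
          (im_mem (a := a) (j := j) (M := M + 1) (by omega))
          (im_mem (a := a + 2) (j := j) (M := M + 1) (by omega)))) using 1
      ext p
      have := normSq_sphereW p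
      simp only [Pi.mul_apply, Pi.smul_apply, Pi.sub_apply, smul_eq_mul, pow_succ,
        Complex.mul_re, Complex.mul_im]
      simp only [sphereW]
      linear_combination (-(1 / 2) * p.1 2 ^ a * ((⟨p.1 0, p.1 1⟩ : ℂ) ^ j).im) * this
  · rcases j with _ | j
    · convert Submodule.zero_mem _ using 1
      ext p; simp
    · convert Submodule.sub_mem _ (Submodule.smul_mem _ (1 / 2 : ℝ) (Submodule.sub_mem _
          (re_mem (a := a) (j := j) (M := M + 1) (by omega))
          (re_mem (a := a + 2) (j := j) (M := M + 1) (by omega))))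
        (Submodule.smul_mem _ (1 / 2 : ℝ)
        (re_mem (a := a) (j := j + 2) (M := M + 1) (by omega))) using 1
      ext p
      have := normSq_sphereW p
      simp only [Pi.mul_apply, Pi.smul_apply, Pi.sub_apply, smul_eq_mul, pow_succ,
        Complex.mul_re, Complex.mul_im]
      simp only [sphereW]
      linear_combination (1 / 2 * p.1 2 ^ a * ((⟨p.1 0, p.1 1⟩ : ℂ) ^ j).re) * this

theorem monomial_mem_span (a b c : ℕ) :
    (fun p : UnitSphere2 => p.1 0 ^ a * p.1 1 ^ b * p.1 2 ^ c) ∈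
      Submodule.span ℝ (azimuthalGenerators (a + b + c + 1)) := by
  induction a with
  | zero =>
    induction b with
    | zero => convert re_mem (a := c) (j := 0) (M := 0 + 0 + c + 1) (by omega) using 1; ext p; simp
    | succ b ih =>
      have h := coord_one_mul_mem ih
      rw [show 0 + b + c + 1 + 1 = 0 + (b + 1) + c + 1 by ring] at h
      convert h using 1
      ext p; simp only [Pi.mul_apply]; ring
  | succ a ih =>
    have h := coord_zero_mul_mem ih
    rw [show a + b + c + 1 + 1 = a + 1 + b + c + 1 by ring] at h
    convert h using 1
    ext p; simp only [Pi.mul_apply]; ring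

theorem azimuthalGenerators_mono {M M' : ℕ} (h : M ≤ M') :
    azimuthalGenerators M ⊆ azimuthalGenerators M' := by
  rintro f ⟨a, j, haj, hf⟩
  exact ⟨a, j, haj.trans_le h, hf⟩

theorem sphericalPoly_le_span (n : ℕ) :
    sphericalPoly n ≤ Submodule.span ℝ (azimuthalGenerators (n + 1)) := by
  intro T hT
  obtain ⟨P, hP, h⟩ := (mem_sphericalPoly_natCast n T).1 hT
  have : T = ∑ d ∈ P.support, P.coeff d •
      fun p : UnitSphere2 => p.1 0 ^ d 0 * p.1 1 ^ d 1 * p.1 2 ^ d 2 := by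
    ext p
    rw [h p, MvPolynomial.eval_eq', Finset.sum_apply]
    simp [Fin.prod_univ_three]
  rw [this]
  refine Submodule.sum_mem _ fun d hd => Submodule.smul_mem _ _ ?_
  refine Submodule.span_mono (azimuthalGenerators_mono ?_) (monomial_mem_span _ _ _)
  have := (MvPolynomial.le_totalDegree hd).trans hP
  rw [Finsupp.sum_fintype _ _ (fun _ => rfl), Fin.sum_univ_three] at this
  omega

/-- `T` is a combination of the `Re (x + i y) ^ j`, `Im (x + i y) ^ j` whose coefficients are
polynomials in `z` of degree less than `M - j`. -/
def HasAzimuthalExpansion (M : ℕ) (T : UnitSphere2 → ℝ) : Prop :=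
  ∃ P Q : ℕ → Polynomial ℝ, (∀ j, P j ∈ Polynomial.degreeLT ℝ (M - j)) ∧
    (∀ j, Q j ∈ Polynomial.degreeLT ℝ (M - j)) ∧
    ∀ p : UnitSphere2, T p = ∑ j ∈ Finset.range M,
      ((P j).eval (p.1 2) * (sphereW p ^ j).re + (Q j).eval (p.1 2) * (sphereW p ^ j).im)

theorem hasAzimuthalExpansion_of_mem_span {M : ℕ} {T : UnitSphere2 → ℝ}
    (hT : T ∈ Submodule.span ℝ (azimuthalGenerators M)) : HasAzimuthalExpansion M T := by
  have hX : ∀ {a j : ℕ}, a + j < M → ∀ i, (if i = j then Polynomial.X ^ a else 0) ∈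
      Polynomial.degreeLT ℝ (M - i) := by
    intro a j h i
    split_ifs with hij
    · rw [Polynomial.mem_degreeLT, Polynomial.degree_X_pow]
      have : a < M - i := by omega
      exact_mod_cast this
    · exact Submodule.zero_mem _
  induction hT using Submodule.span_induction with
  | mem f hf =>
    obtain ⟨a, j, h, rfl | rfl⟩ := hf
    · refine ⟨fun i => if i = j then Polynomial.X ^ a else 0, fun _ => 0, hX h,
        fun _ => Submodule.zero_mem _, fun p => ?_⟩
      rw [Finset.sum_eq_single j]
      · simp
      · intro i _ hi; simp [hi]
      · intro hj; exact absurd (Finset.mem_range.2 (by omega)) hj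
    · refine ⟨fun _ => 0, fun i => if i = j then Polynomial.X ^ a else 0,
        fun _ => Submodule.zero_mem _, hX h, fun p => ?_⟩
      rw [Finset.sum_eq_single j]
      · simp
      · intro i _ hi; simp [hi]
      · intro hj; exact absurd (Finset.mem_range.2 (by omega)) hj
  | zero =>
    exact ⟨fun _ => 0, fun _ => 0, fun _ => Submodule.zero_mem _, fun _ => Submodule.zero_mem _,
      fun p => by simp⟩
  | add f g _ _ hf hg =>
    obtain ⟨P, Q, hP, hQ, h⟩ := hf
    obtain ⟨P', Q', hP', hQ', h'⟩ := hg
    refine ⟨P + P', Q + Q', fun j => Submodule.add_mem _ (hP j) (hP' j),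
      fun j => Submodule.add_mem _ (hQ j) (hQ' j), fun p => ?_⟩
    rw [Pi.add_apply, h, h', ← Finset.sum_add_distrib]
    refine Finset.sum_congr rfl fun j _ => ?_
    simp only [Pi.add_apply, Polynomial.eval_add]
    ring
  | smul c f _ hf =>
    obtain ⟨P, Q, hP, hQ, h⟩ := hf
    refine ⟨c • P, c • Q, fun j => Submodule.smul_mem _ _ (hP j),
      fun j => Submodule.smul_mem _ _ (hQ j), fun p => ?_⟩
    rw [Pi.smul_apply, h, Finset.smul_sum]
    refine Finset.sum_congr rfl fun j _ => ?_
    simp only [Pi.smul_apply, Polynomial.eval_smul, smul_eq_mul]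
    ring

/-! ### From the expansion back to spherical polynomials -/

theorem sphericalPoly_mono {m n : ℤ} (h : m ≤ n) : sphericalPoly m ≤ sphericalPoly n :=
  Submodule.map_mono fun _ hP => (MvPolynomial.mem_restrictSupport_iff ℝ).2
    (((MvPolynomial.mem_restrictSupport_iff ℝ).1 hP).trans fun _ hd => le_trans hd h)

theorem mul_mem_sphericalPoly {a b : ℕ} {f g : UnitSphere2 → ℝ}
    (hf : f ∈ sphericalPoly a) (hg : g ∈ sphericalPoly b) :
    f * g ∈ sphericalPoly ((a + b : ℕ) : ℤ) := by
  obtain ⟨P, hP, h⟩ := (mem_sphericalPoly_natCast _ _).1 hf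
  obtain ⟨Q, hQ, h'⟩ := (mem_sphericalPoly_natCast _ _).1 hg
  refine (mem_sphericalPoly_natCast _ _).2
    ⟨P * Q, (MvPolynomial.totalDegree_mul _ _).trans (add_le_add hP hQ), fun p => ?_⟩
  rw [Pi.mul_apply, h, h', map_mul]

theorem coord_mem_sphericalPoly (i : Fin 3) :
    (fun p : UnitSphere2 => p.1 i) ∈ sphericalPoly (1 : ℕ) :=
  (mem_sphericalPoly_natCast _ _).2
    ⟨MvPolynomial.X i, (MvPolynomial.totalDegree_X i).le, fun p => by simp⟩

theorem one_mem_sphericalPoly : (fun _ : UnitSphere2 => (1 : ℝ)) ∈ sphericalPoly (0 : ℕ) :=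
  (mem_sphericalPoly_natCast _ _).2 ⟨1, by simp, fun p => by simp⟩

theorem sphereW_pow_mem (j : ℕ) :
    (fun p : UnitSphere2 => (sphereW p ^ j).re) ∈ sphericalPoly j ∧
      (fun p : UnitSphere2 => (sphereW p ^ j).im) ∈ sphericalPoly j := by
  induction j with
  | zero =>
    constructor
    · simpa using one_mem_sphericalPoly
    · convert Submodule.zero_mem _ using 1
      ext p; simp
  | succ j ih =>
    constructor
    · convert Submodule.sub_mem _ (mul_mem_sphericalPoly ih.1 (coord_mem_sphericalPoly 0))
        (mul_mem_sphericalPoly ih.2 (coord_mem_sphericalPoly 1)) using 1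
      ext p; simp [pow_succ, sphereW]
    · convert Submodule.add_mem _ (mul_mem_sphericalPoly ih.1 (coord_mem_sphericalPoly 1))
        (mul_mem_sphericalPoly ih.2 (coord_mem_sphericalPoly 0)) using 1
      ext p; simp [pow_succ, sphereW]

theorem coord_pow_mem_sphericalPoly (i : Fin 3) (a : ℕ) :
    (fun p : UnitSphere2 => p.1 i ^ a) ∈ sphericalPoly a := by
  induction a with
  | zero => simpa using one_mem_sphericalPoly
  | succ a ih =>
    convert mul_mem_sphericalPoly ih (coord_mem_sphericalPoly i) using 1
    ext p; simp only [Pi.mul_apply]; ring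

theorem eval_mul_mem_sphericalPoly {M j : ℕ} (hj : j < M) {P : Polynomial ℝ}
    (hP : P ∈ Polynomial.degreeLT ℝ (M - j)) {f : UnitSphere2 → ℝ} (hf : f ∈ sphericalPoly j) :
    (fun p : UnitSphere2 => P.eval (p.1 2) * f p) ∈ sphericalPoly ((M : ℤ) - 1) := by
  have hd : P.natDegree < M - j := natDegree_lt_of_mem_degreeLT (by omega) hP
  have : (fun p : UnitSphere2 => P.eval (p.1 2) * f p) =
      ∑ a ∈ Finset.range (M - j), P.coeff a • ((fun p : UnitSphere2 => p.1 2 ^ a) * f) := by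
    ext p
    rw [Polynomial.eval_eq_sum_range' hd, Finset.sum_apply, Finset.sum_mul]
    refine Finset.sum_congr rfl fun a _ => ?_
    simp only [Pi.smul_apply, Pi.mul_apply, smul_eq_mul]
    ring
  rw [this]
  refine Submodule.sum_mem _ fun a ha => Submodule.smul_mem _ _ ?_
  refine sphericalPoly_mono ?_ (mul_mem_sphericalPoly (coord_pow_mem_sphericalPoly 2 a) hf)
  have := Finset.mem_range.1 ha
  omega

theorem HasAzimuthalExpansion.mem_sphericalPoly {M : ℕ} {T : UnitSphere2 → ℝ}
    (hT : HasAzimuthalExpansion M T) : T ∈ sphericalPoly ((M : ℤ) - 1) := by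
  obtain ⟨P, Q, hP, hQ, h⟩ := hT
  have : T = ∑ j ∈ Finset.range M, ((fun p : UnitSphere2 => (P j).eval (p.1 2) *
      (sphereW p ^ j).re) + fun p : UnitSphere2 => (Q j).eval (p.1 2) * (sphereW p ^ j).im) := by
    ext p
    rw [h p, Finset.sum_apply]
    rfl
  rw [this]
  refine Submodule.sum_mem _ fun j hj => Submodule.add_mem _ ?_ ?_
  · exact eval_mul_mem_sphericalPoly (Finset.mem_range.1 hj) (hP j) (sphereW_pow_mem j).1
  · exact eval_mul_mem_sphericalPoly (Finset.mem_range.1 hj) (hQ j) (sphereW_pow_mem j).2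

/-! ### Aliasing on a single latitude -/

theorem sphereW_spherePoint_pow (θ φ : ℝ) (j : ℕ) :
    (sphereW (spherePoint θ φ) ^ j).re = Real.sin θ ^ j * Real.cos (j * φ) ∧
      (sphereW (spherePoint θ φ) ^ j).im = Real.sin θ ^ j * Real.sin (j * φ) := by
  have h : sphereW (spherePoint θ φ) = Real.sin θ * Complex.exp (φ * Complex.I) := by
    apply Complex.ext
    · rw [Complex.re_ofReal_mul, Complex.exp_ofReal_mul_I_re]
      simp [sphereW, spherePoint]
    · rw [Complex.im_ofReal_mul, Complex.exp_ofReal_mul_I_im]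
      simp [sphereW, spherePoint]
  have h2 : sphereW (spherePoint θ φ) ^ j =
      ((Real.sin θ ^ j : ℝ) : ℂ) * Complex.exp (((j * φ : ℝ) : ℂ) * Complex.I) := by
    rw [h, mul_pow, ← Complex.exp_nat_mul]
    push_cast
    ring_nf
  rw [h2, Complex.re_ofReal_mul, Complex.im_ofReal_mul, Complex.exp_ofReal_mul_I_re,
    Complex.exp_ofReal_mul_I_im]
  exact ⟨rfl, rfl⟩

/-- Aliasing relations: a trigonometric polynomial of degree less than `2s` that vanishes at the
`2s` equidistant angles `φ` with `exp (2 s i φ) = ε`. -/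
theorem aliasing_of_vanishing {s : ℕ} (hs : 0 < s) {α ε : ℝ}
    (hε : Complex.exp (Complex.I * (α * Real.pi)) = ε) (hε2 : ε ^ 2 = 1) (a b : ℕ → ℝ)
    (h : ∀ l : ℕ, l < 2 * s → ∑ j ∈ Finset.range (2 * s),
      (a j * Real.cos (j * ((2 * l + α) * Real.pi / (2 * s))) +
        b j * Real.sin (j * ((2 * l + α) * Real.pi / (2 * s)))) = 0) :
    a 0 = 0 ∧ ∀ j, 0 < j → j < 2 * s →
      a (2 * s - j) + ε * a j = 0 ∧ b (2 * s - j) - ε * b j = 0 := by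
  have hsC : (s : ℂ) ≠ 0 := by exact_mod_cast hs.ne'
  set node : ℕ → ℂ := fun l => Complex.exp (Complex.I * ((2 * l + α) * Real.pi / (2 * s)))
    with hnode
  have hpow : ∀ l, node l ^ (2 * s) = ε := by
    intro l
    rw [hnode, ← Complex.exp_nat_mul, ← hε]
    rw [Complex.exp_eq_exp_iff_exists_int]
    refine ⟨l, ?_⟩
    push_cast
    field_simp
    ring
  have hinj : Function.Injective fun l : Fin (2 * s) => node l := by
    intro l l' hll
    obtain ⟨k, hk⟩ := Complex.exp_eq_exp_iff_exists_int.1 hll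
    have hpi : (Real.pi : ℂ) ≠ 0 := by exact_mod_cast Real.pi_ne_zero
    have hI := Complex.I_ne_zero
    have hk' : ((l : ℕ) : ℂ) = (l' : ℕ) + k * (2 * s) := by
      field_simp at hk
      linear_combination hk / 2
    have hk'' : ((l : ℕ) : ℤ) = (l' : ℕ) + k * (2 * s) := by exact_mod_cast hk'
    have h1 := l.2
    have h2 := l'.2
    have hk0 : k = 0 := by
      by_contra hne
      rcases lt_or_gt_of_ne hne with h | h <;> nlinarith
    rw [hk0] at hk''
    ext
    omega
  -- After multiplication by 2z^(2s-1), the sum is reduced by z^(2s) = ε to a polynomial `H` of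
  -- degree below 2s with 2s roots. The value of `c` at 2s encodes the term z^(2s-1) of index 0,
  -- which needs no reduction: ε · ε = 1.
  set c : ℕ → ℂ := fun j => if j = 2 * s then ε * (a 0 - b 0 * Complex.I) else
    a j - b j * Complex.I with hc
  set H : Polynomial ℂ := ∑ k ∈ Finset.range (2 * s),
    Polynomial.C ((a (2 * s - 1 - k) + b (2 * s - 1 - k) * Complex.I) + ε * c (k + 1)) *
      Polynomial.X ^ k with hH
  have hεC : (ε : ℂ) ^ 2 = 1 := by exact_mod_cast hε2
  have hH0 : H = 0 := by
    refine Polynomial.eq_zero_of_natDegree_lt_card_of_eval_eq_zero H hinj ?_ ?_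
    · intro l
      set z := node l with hz
      have hl := h l l.2
      have expand : ∀ j : ℕ, ((a j * Real.cos (j * ((2 * (l : ℕ) + α) * Real.pi / (2 * s))) +
          b j * Real.sin (j * ((2 * (l : ℕ) + α) * Real.pi / (2 * s))) : ℝ) : ℂ) * (2 * z ^ j) =
          (a j - b j * Complex.I) * z ^ (2 * j) + (a j + b j * Complex.I) := by
        intro j
        have hzj : z ^ j = Complex.exp ((j * ((2 * (l : ℕ) + α) * Real.pi / (2 * s)) : ℂ) *
            Complex.I) := by
          rw [hz, hnode, ← Complex.exp_nat_mul]
          congr 1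
          ring
        have hcs := Complex.cos_sq_add_sin_sq
          ((j * ((2 * (l : ℕ) + α) * Real.pi / (2 * s)) : ℂ))
        rw [mul_comm 2 j, pow_mul, hzj, Complex.exp_mul_I]
        push_cast
        linear_combination (a j + b j * Complex.I) * hcs +
          (b j * (Complex.sin ((j * ((2 * (l : ℕ) + α) * Real.pi / (2 * s)) : ℂ))) ^ 2 * Complex.I
            + 2 * b j * Complex.cos ((j * ((2 * (l : ℕ) + α) * Real.pi / (2 * s)) : ℂ)) *
             Complex.sin ((j * ((2 * (l : ℕ) + α) * Real.pi / (2 * s)) : ℂ))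
            - a j * Complex.sin ((j * ((2 * (l : ℕ) + α) * Real.pi / (2 * s)) : ℂ)) ^ 2) *
            Complex.I_sq
      have hsum : ∑ j ∈ Finset.range (2 * s), (a j - b j * Complex.I) * z ^ (2 * s - 1 + j) +
          ∑ j ∈ Finset.range (2 * s), (a j + b j * Complex.I) * z ^ (2 * s - 1 - j) = 0 := by
        have h2 : (2 * z ^ (2 * s - 1)) * ((∑ j ∈ Finset.range (2 * s),
            (a j * Real.cos (j * ((2 * (l : ℕ) + α) * Real.pi / (2 * s))) +
            b j * Real.sin (j * ((2 * (l : ℕ) + α) * Real.pi / (2 * s)))) : ℝ) : ℂ) = 0 := by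
          rw [hl]; simp
        rw [← h2, Complex.ofReal_sum, Finset.mul_sum, ← Finset.sum_add_distrib]
        refine Finset.sum_congr rfl fun j hj => ?_
        have hj' : j ≤ 2 * s - 1 := by have := Finset.mem_range.1 hj; omega
        have e := expand j
        have p1 : z ^ (2 * s - 1) = z ^ (2 * s - 1 - j) * z ^ j := by
          rw [← pow_add]; congr 1; omega
        have p2 : z ^ (2 * s - 1 + j) = z ^ (2 * s - 1 - j) * z ^ (2 * j) := by
          rw [← pow_add]; congr 1; omega
        rw [p1, p2]
        linear_combination (-z ^ (2 * s - 1 - j)) * e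
      have first : ∑ j ∈ Finset.range (2 * s), (a j + b j * Complex.I) * z ^ (2 * s - 1 - j) =
          ∑ k ∈ Finset.range (2 * s),
            (a (2 * s - 1 - k) + b (2 * s - 1 - k) * Complex.I) * z ^ k := by
        rw [← Finset.sum_range_reflect]
        refine Finset.sum_congr rfl fun j hj => ?_
        have hj' := Finset.mem_range.1 hj
        rw [show 2 * s - 1 - (2 * s - 1 - j) = j by omega]
      have second : ∑ j ∈ Finset.range (2 * s), (a j - b j * Complex.I) * z ^ (2 * s - 1 + j) =
          ∑ k ∈ Finset.range (2 * s), ε * c (k + 1) * z ^ k := by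
        obtain ⟨r, hr⟩ : ∃ r, 2 * s = r + 1 := ⟨2 * s - 1, by omega⟩
        have hp : z ^ (r + 1) = ε := by rw [← hr]; exact hpow l
        rw [hr, Finset.sum_range_succ', Finset.sum_range_succ]
        congr 1
        · refine Finset.sum_congr rfl fun j hj => ?_
          have hj' := Finset.mem_range.1 hj
          rw [hc]
          simp only
          rw [if_neg (by omega), show r + 1 - 1 + (j + 1) = (r + 1) + j by omega, pow_add, hp]
          ring
        · rw [hc]
          simp only
          rw [if_pos hr.symm]
          simp only [Nat.add_sub_cancel, add_zero]
          linear_combination (-(a 0 - b 0 * Complex.I) * z ^ r) * hεC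
      rw [first, second] at hsum
      rw [hH, Polynomial.eval_finsetSum, ← hsum, ← Finset.sum_add_distrib]
      refine Finset.sum_congr rfl fun k _ => ?_
      simp only [Polynomial.eval_mul, Polynomial.eval_C, Polynomial.eval_pow, Polynomial.eval_X]
      ring
    · rw [Fintype.card_fin]
      refine natDegree_lt_of_mem_degreeLT (by omega) (Submodule.sum_mem _ fun k hk => ?_)
      rw [Polynomial.mem_degreeLT]
      refine (Polynomial.degree_C_mul_X_pow_le _ _).trans_lt ?_
      exact_mod_cast Finset.mem_range.1 hk
  have hcoef : ∀ k, k < 2 * s →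
      (a (2 * s - 1 - k) + b (2 * s - 1 - k) * Complex.I) + ε * c (k + 1) = 0 := by
    intro k hk
    have := congrArg (fun p => Polynomial.coeff p k) hH0
    rw [hH] at this
    simp only [Polynomial.finsetSum_coeff, Polynomial.coeff_C_mul, Polynomial.coeff_X_pow,
      mul_ite, mul_one, mul_zero, Finset.sum_ite_eq, Finset.mem_range, hk, if_true,
      Polynomial.coeff_zero] at this
    exact this
  constructor
  · have := hcoef (2 * s - 1) (by omega)
    rw [hc] at this
    simp only at this
    rw [if_pos (by omega), Nat.sub_self] at this
    have h2 : (2 * a 0 : ℂ) = 0 := by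
      linear_combination this - (a 0 - b 0 * Complex.I) * hεC
    have h3 : 2 * a 0 = 0 := by exact_mod_cast h2
    linarith
  · intro j hj hj2
    have := hcoef (j - 1) (by omega)
    rw [hc] at this
    simp only at this
    rw [if_neg (by omega), show 2 * s - 1 - (j - 1) = 2 * s - j by omega,
      show j - 1 + 1 = j by omega] at this
    have hre := congrArg Complex.re this
    have him := congrArg Complex.im this
    simp at hre him
    constructor <;> linarith

/-- Indices j and 2s - j are treated together. If the larger one reaches s + lam, its polynomial is
zero by degree and the relation for the other becomes plain vanishing; otherwise both polynomials
vanish identically by `eq_zero_of_mirror_zeros`. -/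
theorem eval_eq_zero_of_mirror_relations {s lam : ℕ} (hl : lam ≤ s) {x : ℕ → ℝ}
    (hinj : Set.InjOn x (Finset.Icc 1 lam))
    (hside : (∀ i ∈ Finset.Icc 1 lam, 0 < x i) ∨ (∀ i ∈ Finset.Icc 1 lam, x i < 0))
    {P : ℕ → Polynomial ℝ} (hP : ∀ j, P j ∈ Polynomial.degreeLT ℝ (s + lam - j)) (hlam : 0 < lam)
    {δ : ℝ} (hδ : δ ≠ 0)
    (h₁ : ∀ i ∈ Finset.Icc 1 lam, ∀ j, 0 < j → j ≤ s →
      (P j).eval (x i) + δ * ((1 - x i ^ 2) ^ (s - j) * (P (2 * s - j)).eval (x i)) = 0)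
    (h₂ : ∀ i ∈ Finset.Icc 1 lam, ∀ j, 0 < j → j ≤ s →
      (P j).eval (-x i) - δ * ((1 - x i ^ 2) ^ (s - j) * (P (2 * s - j)).eval (-x i)) = 0)
    {j : ℕ} (hj : 0 < j) {i : ℕ} (hi : i ∈ Finset.Icc 1 lam) :
    (P j).eval (x i) = 0 ∧ (P j).eval (-x i) = 0 := by
  have hzero : ∀ j, s + lam ≤ j → P j = 0 := by
    intro j hj
    have := hP j
    rw [Nat.sub_eq_zero_of_le hj, Polynomial.mem_degreeLT] at this
    simpa [Polynomial.degree_lt_iff_coeff_zero, Polynomial.ext_iff] using this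
  -- Here N = s - j < lam, and the degree bounds s + lam - j and s + lam - (2s - j) are exactly lam
  -- + N and lam - N.
  have hboth : ∀ j, 0 < j → j ≤ s → s < lam + j → P j = 0 ∧ P (2 * s - j) = 0 := by
    intro j hj hjs hjl
    have hc : (Finset.Icc 1 lam).card = lam := by simp
    have := eq_zero_of_mirror_zeros hinj hside (N := s - j) (u := P j)
      (v := δ • P (2 * s - j)) (by rw [hc]; omega)
      (by rw [hc]; convert hP j using 2; omega)
      (by rw [hc]; convert Submodule.smul_mem _ δ (hP (2 * s - j)) using 2; omega)
      (fun i hi => by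
        rw [Polynomial.eval_smul, smul_eq_mul]; linear_combination h₁ i hi j hj hjs)
      (fun i hi => by
        rw [Polynomial.eval_smul, smul_eq_mul]; linear_combination h₂ i hi j hj hjs)
    exact ⟨this.1, (smul_eq_zero.1 this.2).resolve_left hδ⟩
  rcases le_or_gt j s with hjs | hjs
  · rcases lt_or_ge s (lam + j) with h | h
    · simp [(hboth j hj hjs h).1]
    · have h0 := hzero (2 * s - j) (by omega)
      have e₁ := h₁ i hi j hj hjs
      have e₂ := h₂ i hi j hj hjs
      rw [h0] at e₁ e₂
      simpa using And.intro e₁ e₂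
  · rcases le_or_gt (s + lam) j with h | h
    · simp [hzero j h]
    · have := (hboth (2 * s - j) (by omega) (by omega) (by omega)).2
      rw [show 2 * s - (2 * s - j) = j by omega] at this
      simp [this]

/-- The aliasing relations are applied to the Fourier coefficients sin^j θ · P_j(cos θ), padded by
zeros up to index 2s. Dividing by sin^j θ ≠ 0 leaves the weight sin^(2(s-j)) θ = (1 - cos² θ)^(s-j).
-/
theorem latitude_relations {s M : ℕ} (hs : 0 < s) (hM : M ≤ 2 * s) {P Q : ℕ → Polynomial ℝ}
    (hP : ∀ j, M ≤ j → P j = 0) (hQ : ∀ j, M ≤ j → Q j = 0) {T : UnitSphere2 → ℝ}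
    (hT : ∀ p : UnitSphere2, T p = ∑ j ∈ Finset.range M,
      ((P j).eval (p.1 2) * (sphereW p ^ j).re + (Q j).eval (p.1 2) * (sphereW p ^ j).im))
    {α ε : ℝ} (hε : Complex.exp (Complex.I * (α * Real.pi)) = ε) (hε2 : ε ^ 2 = 1)
    {θ : ℝ} (hθ : θ ∈ Set.Ioo 0 Real.pi)
    (h : ∀ φ ∈ equidistantAngles α s, inAngles T θ φ = 0) :
    (P 0).eval (Real.cos θ) = 0 ∧ ∀ j, 0 < j → j ≤ s →
      (P j).eval (Real.cos θ) +
        ε * ((1 - Real.cos θ ^ 2) ^ (s - j) * (P (2 * s - j)).eval (Real.cos θ)) = 0 ∧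
      (Q j).eval (Real.cos θ) -
        ε * ((1 - Real.cos θ ^ 2) ^ (s - j) * (Q (2 * s - j)).eval (Real.cos θ)) = 0 := by
  have hsin : Real.sin θ ≠ 0 := (Real.sin_pos_of_mem_Ioo hθ).ne'
  have key := aliasing_of_vanishing hs hε hε2
    (fun j => Real.sin θ ^ j * (P j).eval (Real.cos θ))
    (fun j => Real.sin θ ^ j * (Q j).eval (Real.cos θ)) (fun l hl => by
      rw [← h ((2 * l + α) * Real.pi / (2 * s)) ⟨l, by omega, by omega, by push_cast; rfl⟩,
        inAngles, hT]
      rw [← Finset.sum_subset (Finset.range_mono hM)]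
      · refine Finset.sum_congr rfl fun j _ => ?_
        rw [(sphereW_spherePoint_pow _ _ _).1, (sphereW_spherePoint_pow _ _ _).2]
        simp only [spherePoint]
        simp
        ring
      · intro j _ hj
        have hj' : M ≤ j := by simpa using hj
        simp [hP j hj', hQ j hj'])
  refine ⟨by simpa using key.1, fun j hj hjs => ?_⟩
  have hp : Real.sin θ ^ (2 * s - j) = Real.sin θ ^ j * (1 - Real.cos θ ^ 2) ^ (s - j) := by
    rw [← Real.sin_sq, ← pow_mul, ← pow_add]
    congr 1
    omega
  obtain ⟨ha, hb⟩ := key.2 j hj (by omega)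
  simp only [hp] at ha hb
  have hj0 := pow_ne_zero j hsin
  constructor
  · apply mul_left_cancel₀ hj0
    linear_combination ε * ha - Real.sin θ ^ j * (P j).eval (Real.cos θ) * hε2
  · apply mul_left_cancel₀ hj0
    linear_combination (-ε) * hb - Real.sin θ ^ j * (Q j).eval (Real.cos θ) * hε2

/-! ### Factoring out one group of latitudes, then all of them -/

/-- Vanishing at equidistant nodes on `lam` mirror pairs of latitudes, rotated between the two
hemispheres, forces divisibility by the corresponding product. -/
theorem HasAzimuthalExpansion.exists_factor {s lam : ℕ} (hlam : 0 < lam) (hl : lam ≤ s)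
    {θ : ℕ → ℝ} (hrange : ∀ i ∈ Finset.Icc 1 (2 * lam), θ i ∈ Set.Ioo 0 Real.pi)
    (hinj : Set.InjOn θ (Finset.Icc 1 (2 * lam)))
    (hsymm : ∀ l, 1 ≤ l → l ≤ lam → θ (2 * lam + 1 - l) = Real.pi - θ l)
    (hside : (∀ i, 1 ≤ i → i ≤ lam → θ i < Real.pi / 2) ∨
      (∀ i, 1 ≤ i → i ≤ lam → Real.pi / 2 < θ i))
    {T : UnitSphere2 → ℝ} (hT : HasAzimuthalExpansion (s + lam) T)
    (h₀ : ∀ i, 1 ≤ i → i ≤ lam → ∀ φ ∈ equidistantAngles 0 s, inAngles T (θ i) φ = 0)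
    (h₁ : ∀ i, lam + 1 ≤ i → i ≤ 2 * lam → ∀ φ ∈ equidistantAngles 1 s,
      inAngles T (θ i) φ = 0) :
    ∃ T', HasAzimuthalExpansion (s - lam) T' ∧ ∀ p : UnitSphere2,
      T p = (∏ i ∈ Finset.Icc 1 (2 * lam), (p.1 2 - Real.cos (θ i))) * T' p := by
  obtain ⟨P, Q, hP, hQ, hPQ⟩ := hT
  have hzero : ∀ {P : ℕ → Polynomial ℝ}, (∀ j, P j ∈ Polynomial.degreeLT ℝ (s + lam - j)) →
      ∀ j, s + lam ≤ j → P j = 0 := by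
    intro P hP j hj
    have := hP j
    rw [Nat.sub_eq_zero_of_le hj, Polynomial.mem_degreeLT] at this
    simpa [Polynomial.degree_lt_iff_coeff_zero, Polynomial.ext_iff] using this
  have hcosinj : Set.InjOn (fun i => Real.cos (θ i)) (Finset.Icc 1 (2 * lam)) := by
    intro i hi j hj hij
    exact hinj hi hj (Real.injOn_cos (Set.Ioo_subset_Icc_self (hrange i hi))
      (Set.Ioo_subset_Icc_self (hrange j hj)) hij)
  have hsub : Finset.Icc 1 lam ⊆ Finset.Icc 1 (2 * lam) :=
    Finset.Icc_subset_Icc_right (by omega)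
  have hmem : ∀ {i}, 1 ≤ i → i ≤ 2 * lam → θ i ∈ Set.Ioo 0 Real.pi := fun h h' =>
    hrange _ (Finset.mem_Icc.2 ⟨h, h'⟩)
  have north : ∀ i ∈ Finset.Icc 1 lam, _ := fun i hi =>
    latitude_relations (s := s) (M := s + lam) (by omega) (by omega) (hzero hP) (hzero hQ) hPQ
      (α := 0) (ε := 1) (by simp) (by norm_num) (hrange i (hsub hi))
      (h₀ i (Finset.mem_Icc.1 hi).1 (Finset.mem_Icc.1 hi).2)
  have south : ∀ i, lam + 1 ≤ i → i ≤ 2 * lam → _ := fun i hi hi' =>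
    latitude_relations (s := s) (M := s + lam) (by omega) (by omega) (hzero hP) (hzero hQ) hPQ
      (α := 1) (ε := -1) (by
        rw [mul_comm, Complex.ofReal_one, one_mul, Complex.exp_pi_mul_I]; simp) (by norm_num)
      (hmem (by omega) hi') (h₁ i hi hi')
  have hcos : ∀ l ∈ Finset.Icc 1 lam, Real.cos (θ (2 * lam + 1 - l)) = -Real.cos (θ l) := by
    intro l hl
    rw [hsymm l (Finset.mem_Icc.1 hl).1 (Finset.mem_Icc.1 hl).2, Real.cos_pi_sub]
  have mirror : ∀ l ∈ Finset.Icc 1 lam, _ := fun l hl =>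
    south (2 * lam + 1 - l) (by have := Finset.mem_Icc.1 hl; omega)
      (by have := Finset.mem_Icc.1 hl; omega)
  have hside' : (∀ i ∈ Finset.Icc 1 lam, 0 < Real.cos (θ i)) ∨
      (∀ i ∈ Finset.Icc 1 lam, Real.cos (θ i) < 0) := by
    rcases hside with h | h
    · left
      intro i hi
      have := hrange i (hsub hi)
      have hi' := Finset.mem_Icc.1 hi
      exact Real.cos_pos_of_mem_Ioo ⟨by linarith [this.1, Real.pi_pos], h i hi'.1 hi'.2⟩
    · right
      intro i hi
      have := hrange i (hsub hi)
      have hi' := Finset.mem_Icc.1 hi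
      exact Real.cos_neg_of_pi_div_two_lt_of_lt (h i hi'.1 hi'.2)
        (by linarith [this.2, Real.pi_pos])
  have spread : ∀ {f : Polynomial ℝ}, (∀ i ∈ Finset.Icc 1 lam, f.eval (Real.cos (θ i)) = 0 ∧
      f.eval (-Real.cos (θ i)) = 0) →
      ∀ i ∈ Finset.Icc 1 (2 * lam), f.eval (Real.cos (θ i)) = 0 := by
    intro f hf i hi
    have hi' := Finset.mem_Icc.1 hi
    rcases le_or_gt i lam with h | h
    · exact (hf i (Finset.mem_Icc.2 ⟨hi'.1, h⟩)).1
    · have hm : 2 * lam + 1 - i ∈ Finset.Icc 1 lam := Finset.mem_Icc.2 ⟨by omega, by omega⟩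
      have := (hf _ hm).2
      rw [← hcos _ hm, show 2 * lam + 1 - (2 * lam + 1 - i) = i by omega] at this
      exact this
  have hP0 : ∀ j, ∀ i ∈ Finset.Icc 1 (2 * lam), (P j).eval (Real.cos (θ i)) = 0 := by
    intro j
    refine spread fun i hi => ?_
    rcases Nat.eq_zero_or_pos j with rfl | hj
    · refine ⟨(north i hi).1, ?_⟩
      rw [← hcos i hi]
      exact (mirror i hi).1
    -- The sign is δ = 1 for the cosine coefficients and δ = -1 for the sine coefficients; ε = -1 on
    -- the mirrored latitudes reverses it there.
    · refine eval_eq_zero_of_mirror_relations hl (x := fun i => Real.cos (θ i))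
        (hcosinj.mono (by exact_mod_cast hsub)) hside' hP hlam (δ := 1) one_ne_zero
        (fun i hi j hj hjs => ((north i hi).2 j hj hjs).1) (fun i hi j hj hjs => ?_) hj hi
      have := ((mirror i hi).2 j hj hjs).1
      rw [hcos i hi, neg_sq] at this
      linear_combination this
  have hQ0 : ∀ j, 0 < j → ∀ i ∈ Finset.Icc 1 (2 * lam), (Q j).eval (Real.cos (θ i)) = 0 := by
    intro j hj
    refine spread fun i hi => ?_
    refine eval_eq_zero_of_mirror_relations hl (x := fun i => Real.cos (θ i))
      (hcosinj.mono (by exact_mod_cast hsub)) hside' hQ hlam (δ := -1) (by norm_num)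
      (fun i hi j hj hjs => ?_) (fun i hi j hj hjs => ?_) hj hi
    · have := ((north i hi).2 j hj hjs).2
      linear_combination this
    · have := ((mirror i hi).2 j hj hjs).2
      rw [hcos i hi, neg_sq] at this
      linear_combination this
  have hdeg : ∀ j, s + lam - j - (Finset.Icc 1 (2 * lam)).card = s - lam - j := by
    intro j; rw [Nat.card_Icc]; omega
  choose P' hP' hPP' using fun j => exists_prod_X_sub_C_mul hcosinj (hP0 j) (hP j)
  -- Nothing is known about `Q 0`, but it multiplies Im w^0 = 0, so 0 serves as its quotient.
  have hQex : ∀ j, ∃ g ∈ Polynomial.degreeLT ℝ (s - lam - j), 0 < j →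
      Q j = (∏ i ∈ Finset.Icc 1 (2 * lam), (Polynomial.X - Polynomial.C (Real.cos (θ i)))) * g := by
    intro j
    rcases Nat.eq_zero_or_pos j with rfl | hj
    · exact ⟨0, Submodule.zero_mem _, fun h => absurd h (lt_irrefl _)⟩
    · obtain ⟨g, hg, hg'⟩ := exists_prod_X_sub_C_mul hcosinj (hQ0 j hj) (hQ j)
      exact ⟨g, hdeg j ▸ hg, fun _ => hg'⟩
  choose Q' hQ' hQQ' using hQex
  have hP'' : ∀ j, P' j ∈ Polynomial.degreeLT ℝ (s - lam - j) := fun j => hdeg j ▸ hP' j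
  have hbig : ∀ {R : ℕ → Polynomial ℝ}, (∀ j, R j ∈ Polynomial.degreeLT ℝ (s - lam - j)) →
      ∀ j, s - lam ≤ j → R j = 0 := by
    intro R hR j hj
    have := hR j
    rw [Nat.sub_eq_zero_of_le hj, Polynomial.mem_degreeLT] at this
    simpa [Polynomial.degree_lt_iff_coeff_zero, Polynomial.ext_iff] using this
  refine ⟨_, ⟨P', Q', hP'', hQ', fun p => rfl⟩, fun p => ?_⟩
  rw [hPQ, Finset.sum_subset (s₁ := Finset.range (s - lam)) (s₂ := Finset.range (s + lam))
    (Finset.range_mono (by omega)), Finset.mul_sum]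
  · refine Finset.sum_congr rfl fun j _ => ?_
    have hev : (∏ i ∈ Finset.Icc 1 (2 * lam),
        (Polynomial.X - Polynomial.C (Real.cos (θ i)))).eval (p.1 2) =
        ∏ i ∈ Finset.Icc 1 (2 * lam), (p.1 2 - Real.cos (θ i)) := by
      rw [Polynomial.eval_prod]; simp
    rcases Nat.eq_zero_or_pos j with rfl | hj
    · rw [hPP' 0, Polynomial.eval_mul, hev]
      simp
    · rw [hPP' j, hQQ' j hj, Polynomial.eval_mul, Polynomial.eval_mul, hev]
      ring
  · intro j _ hj
    have hj' : s - lam ≤ j := by simpa using hj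
    rw [hbig hP'' j hj', hbig hQ' j hj']
    simp


/-- Here `lam k` is `λ_k` and `θ i k` is `θ_{i,k}`, for `1 ≤ k ≤ σ` and `1 ≤ i ≤ 2 λ_k`; the values
of `lam` and `θ` at other indices play no role. -/
theorem mainTheorem3 (n : ℕ) (hn : Odd n) (σ : ℕ) (hσ : 1 ≤ σ)
    (lam : ℕ → ℕ) (hlam : ∀ k, 1 ≤ k → k ≤ σ → 0 < lam k)
    (hnonneg : ∀ k, 1 ≤ k → k < σ → 0 ≤ degreeSeq n lam k)
    (hlast : -1 ≤ degreeSeq n lam σ)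
    (θ : ℕ → ℕ → ℝ)
    (hrange : ∀ k, 1 ≤ k → k ≤ σ → ∀ i, 1 ≤ i → i ≤ 2 * lam k →
      θ i k ∈ Set.Ioo 0 Real.pi)
    (hdistinct : ∀ k, 1 ≤ k → k ≤ σ → ∀ i, 1 ≤ i → i ≤ 2 * lam k →
      ∀ k', 1 ≤ k' → k' ≤ σ → ∀ i', 1 ≤ i' → i' ≤ 2 * lam k' →
        θ i k = θ i' k' → i = i' ∧ k = k')
    (hsymm : ∀ k, 1 ≤ k → k ≤ σ → ∀ l, 1 ≤ l → l ≤ lam k →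
      θ (2 * lam k + 1 - l) k = Real.pi - θ l k)
    (hside : ∀ k, 1 ≤ k → k ≤ σ →
      (∀ i, 1 ≤ i → i ≤ lam k → θ i k < Real.pi / 2) ∨
      (∀ i, 1 ≤ i → i ≤ lam k → Real.pi / 2 < θ i k))
    (T : UnitSphere2 → ℝ) (hT : T ∈ sphericalPoly n)
    (hzero₀ : ∀ k, 1 ≤ k → k ≤ σ → ∀ i, 1 ≤ i → i ≤ lam k →
      ∀ φ ∈ equidistantAngles 0 (degreeSeq n lam (k - 1) - lam k + 1),
        inAngles T (θ i k) φ = 0)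
    (hzero₁ : ∀ k, 1 ≤ k → k ≤ σ → ∀ i, lam k + 1 ≤ i → i ≤ 2 * lam k →
      ∀ φ ∈ equidistantAngles 1 (degreeSeq n lam (k - 1) - lam k + 1),
        inAngles T (θ i k) φ = 0) :
    (∃ Tstar ∈ sphericalPoly (degreeSeq n lam σ), ∀ p : UnitSphere2,
      T p = (∏ k ∈ Finset.Icc 1 σ, ∏ i ∈ Finset.Icc 1 (2 * lam k),
        (p.1 2 - Real.cos (θ i k))) * Tstar p) ∧
    (degreeSeq n lam σ < 0 → ∀ p : UnitSphere2, T p = 0) := by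
  have hge : ∀ k, k ≤ σ → -1 ≤ degreeSeq n lam k := by
    intro k hk
    rcases Nat.eq_zero_or_pos k with rfl | hk0
    · simp only [degreeSeq]; omega
    · rcases hk.lt_or_eq with h | rfl
      · linarith [hnonneg k hk0 h]
      · exact hlast
  have main : ∀ k, k ≤ σ → ∃ T', HasAzimuthalExpansion (degreeSeq n lam k + 1).toNat T' ∧
      ∀ p : UnitSphere2, T p = (∏ k ∈ Finset.Icc 1 k, ∏ i ∈ Finset.Icc 1 (2 * lam k),
        (p.1 2 - Real.cos (θ i k))) * T' p := by
    intro k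
    induction k with
    | zero =>
      intro _
      refine ⟨T, ?_, fun p => by simp⟩
      have := hasAzimuthalExpansion_of_mem_span (sphericalPoly_le_span n hT)
      have h0 : (degreeSeq n lam 0 + 1).toNat = n + 1 := by simp only [degreeSeq]; omega
      rwa [h0]
    | succ k ih =>
      intro hk
      obtain ⟨T', hT', hTT'⟩ := ih (by omega)
      have hk1 : 1 ≤ k + 1 := by omega
      have hge' := hge (k + 1) hk
      have hlk := hlam (k + 1) hk1 hk
      have hrec : degreeSeq n lam (k + 1) = degreeSeq n lam k - 2 * lam (k + 1) := rfl
      -- The degree bound plus one is s + λ before the step and s - λ after it; λ ≤ s because the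
      -- new degree is at least -1.
      obtain ⟨s, hs⟩ : ∃ s : ℕ, degreeSeq n lam k - lam (k + 1) + 1 = s :=
        ⟨(degreeSeq n lam k - lam (k + 1) + 1).toNat, by omega⟩
      have e1 : (degreeSeq n lam k + 1).toNat = s + lam (k + 1) := by omega
      have e2 : (degreeSeq n lam (k + 1) + 1).toNat = s - lam (k + 1) := by omega
      rw [e1] at hT'
      -- The factors already extracted do not vanish on the new latitudes, since cosine is injective
      -- on [0, π] and the angles are distinct.
      have transfer : ∀ i, 1 ≤ i → i ≤ 2 * lam (k + 1) → ∀ φ,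
          inAngles T (θ i (k + 1)) φ = 0 → inAngles T' (θ i (k + 1)) φ = 0 := by
        intro i hi hi' φ h
        rw [inAngles, hTT'] at h
        refine (mul_eq_zero.1 h).resolve_left ?_
        refine Finset.prod_ne_zero_iff.2 fun k' hk' => Finset.prod_ne_zero_iff.2 fun i' hi'' => ?_
        rw [Finset.mem_Icc] at hk' hi''
        have hz : (spherePoint (θ i (k + 1)) φ).1 2 = Real.cos (θ i (k + 1)) := by
          simp [spherePoint]
        rw [hz, sub_ne_zero]
        intro hc
        have := Real.injOn_cos
          (Set.Ioo_subset_Icc_self (hrange (k + 1) hk1 hk i hi hi'))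
          (Set.Ioo_subset_Icc_self
            (hrange k' hk'.1 (hk'.2.trans (by omega)) i' hi''.1 hi''.2)) hc
        have := (hdistinct (k + 1) hk1 hk i hi hi' k' hk'.1 (hk'.2.trans (by omega)) i'
          hi''.1 hi''.2 this).2
        omega
      obtain ⟨T'', hT'', hfac⟩ := HasAzimuthalExpansion.exists_factor (s := s)
        (θ := fun i => θ i (k + 1)) hlk (by omega)
        (fun i hi => hrange (k + 1) hk1 hk i (Finset.mem_Icc.1 hi).1 (Finset.mem_Icc.1 hi).2)
        (fun i hi j hj hij => by
          have hi' := Finset.mem_Icc.1 (Finset.mem_coe.1 hi)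
          have hj' := Finset.mem_Icc.1 (Finset.mem_coe.1 hj)
          exact (hdistinct (k + 1) hk1 hk i hi'.1 hi'.2 (k + 1) hk1 hk j hj'.1 hj'.2 hij).1)
        (hsymm (k + 1) hk1 hk) (hside (k + 1) hk1 hk) hT'
        (fun i hi hi' φ hφ => transfer i hi (by omega) φ
          (hzero₀ (k + 1) hk1 hk i hi hi' φ (by rwa [Nat.add_sub_cancel, hs])))
        (fun i hi hi' φ hφ => transfer i (by omega) hi' φ
          (hzero₁ (k + 1) hk1 hk i hi hi' φ (by rwa [Nat.add_sub_cancel, hs])))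
      refine ⟨T'', e2 ▸ hT'', fun p => ?_⟩
      rw [hTT', hfac, Finset.prod_Icc_succ_top hk1, mul_assoc]
  obtain ⟨T', hT', hfac⟩ := main σ le_rfl
  have hmem : T' ∈ sphericalPoly (degreeSeq n lam σ) := by
    have := hT'.mem_sphericalPoly
    rwa [Int.toNat_of_nonneg (by linarith), add_sub_cancel_right] at this
  refine ⟨⟨T', hmem, hfac⟩, fun hneg p => ?_⟩
  rw [sphericalPoly_of_neg hneg, Submodule.mem_bot] at hmem
  rw [hfac, hmem, Pi.zero_apply, mul_zero]
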